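/- Let $n\ge 0$, and let $B_n$ be the set of pairs $(\pi,\epsilon)$ with $\pi\in S_n$ and $\epsilon\in\{1,-1\}^n$. Write $\epsilon_j=(-1)^{c_j}$ with $c_j\in\{0,1\}$, and put $\pi(0)=0$, $\epsilon_0=\epsilon_{n+1}=1$, $c_0=c_{n+1}=0$. For $1\le j\le n$ let $a_j^\epsilon\in\{0,1\}$ be $(c_j-c_{j+1})\bmod 2$, and let $\mathrm{ch}(\epsilon)=\sum_{j=1}^n a_j^\epsilon$. Let $\mathrm{Des}(\pi)=\{j\in[n-1]:\pi(j)>\pi(j+1)\}$ and $[m]_q=1+q+\cdots+q^{m-1}$. Let $R$ be any commutative ring (for instance $\mathbb Z$). (1) In $R[z_1,\dots,z_n][[z_0]]$, $$\sum_{k\ge 0}\ \prod_{j=1}^n[2k+1]_{z_j}\,z_0^k=\sum_{(\pi,\epsilon)\in B_n}\frac{z_0^{\lceil \mathrm{ch}(\epsilon)/2\rceil}\ \prod_{j:\,a_j^\epsilon=1}z_{\pi(1)}z_{\pi(2)}\cdots z_{\pi(j)}\ \prod_{j\in\mathrm{Des}(\pi),\ a_j^\epsilon=0}z_0z_{\pi(1)}^2z_{\pi(2)}^2\cdots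 z_{\pi(j)}^2}{\prod_{j=0}^n\left(1-z_0z_{\pi(1)}^2z_{\pi(2)}^2\cdots z_{\pi(j)}^2\right)}.$$ (2) Order the symbols $j^{c}$ by $j^{c}<k^{d}$ if $c>d$, or if $c=d$ and $j<k$. Let $\mathrm{Des}(\pi,\epsilon)=\{j\in\{0,\dots,n-1\}:\pi(j)^{c_j}>\pi(j+1)^{c_{j+1}}\}$, $\mathrm{neg}(\pi,\epsilon)=\#\{j:\epsilon_j=-1\}$ and $\mathrm{fmajor}(\pi,\epsilon)=2\sum_{j\in\mathrm{Des}(\pi,\epsilon)}j+\mathrm{neg}(\pi,\epsilon)$. Let $\mathrm{NatDes}(\pi,\epsilon)=\{j\in\{0,\dots,n-1\}:\epsilon_j\pi(j)>\epsilon_{j+1}\pi(j+1)\}$, $\mathrm{natdes}(\pi,\epsilon)=\#\mathrm{NatDes}(\pi,\epsilon)$ and $\mathrm{natfmaj}(\pi,\epsilon)=2\sum_{j\in\mathrm{NatDes}(\pi,\epsilon)}j+\mathrm{neg}(\pi,\epsilon)$. There is a bijection $\varphi:B_n\to B_n$ such that, for every $(\pi,\epsilon)$, one has $\varphi(\pi,\epsilon)=(\pi',\epsilon)$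 where $\pi'(j)=\pi(j)$ whenever $\epsilon_j=1$; where $\pi'(i)<\pi'(j)\iff\pi(j)<\pi(i)$ whenever $\epsilon_i=\epsilon_j=-1$; and $\mathrm{NatDes}(\pi',\epsilon)=\mathrm{Des}(\pi,\epsilon)$ and $\mathrm{natfmaj}(\pi',\epsilon)=\mathrm{fmajor}(\pi,\epsilon)$. (3) In $R[q][[t]]$, $$\sum_{k\ge 0}[2k+1]_q^n\,t^k=\frac{\sum_{(\pi,\epsilon)\in B_n}t^{\mathrm{natdes}(\pi,\epsilon)}q^{\mathrm{natfmaj}(\pi,\epsilon)}}{\prod_{j=0}^n(1-tq^{2j})}.$$ -/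

import Mathlib

/-- `B_n`: pairs `(π, ε)` with `π ∈ S_n` and `ε ∈ {1, -1}^n`. The position `j ∈ {1, …, n}` (and the
letter `j`) is the element `j - 1` of `Fin n`. -/
abbrev SignedPerm (n : ℕ) : Type := Equiv.Perm (Fin n) × (Fin n → ℤˣ)

/-- `[m]_q = 1 + q + ⋯ + q^(m-1)`. -/
def qNumber {A : Type*} [CommRing A] (m : ℕ) (q : A) : A := ∑ i ∈ Finset.range m, q ^ i

/-- The value `π(j) ∈ {1, …, n}` for `1 ≤ j ≤ n`, with the conventions `π(0) = 0`,
`π(n+1) = n+1`. -/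
def permVal {n : ℕ} (π : Equiv.Perm (Fin n)) (j : ℕ) : ℕ :=
  if h : 1 ≤ j ∧ j ≤ n then (π ⟨j - 1, by omega⟩ : ℕ) + 1 else j

/-- The sign `ε_j` for `1 ≤ j ≤ n`, with the conventions `ε_0 = ε_{n+1} = 1`. -/
def signVal {n : ℕ} (ε : Fin n → ℤˣ) (j : ℕ) : ℤˣ :=
  if h : 1 ≤ j ∧ j ≤ n then ε ⟨j - 1, by omega⟩ else 1

/-- The color `c_j ∈ {0, 1}`, defined by `ε_j = (-1)^(c_j)`. -/
def color {n : ℕ} (ε : Fin n → ℤˣ) (j : ℕ) : ℕ := if signVal ε j = 1 then 0 else 1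

/-- The `j`th color change `a_j^ε = (c_j - c_{j+1}) mod 2`. -/
def colorChange {n : ℕ} (ε : Fin n → ℤˣ) (j : ℕ) : ℕ :=
  (((color ε j : ℤ) - (color ε (j + 1) : ℤ)) % 2).toNat

/-- The total color change `ch(ε) = a_1^ε + ⋯ + a_n^ε`. -/
def totalColorChange {n : ℕ} (ε : Fin n → ℤˣ) : ℕ := ∑ j ∈ Finset.Icc 1 n, colorChange ε j

/-- `Des(π) = {j ∈ [n-1] : π(j) > π(j+1)}` for `π ∈ S_n`. -/
def permDes {n : ℕ} (π : Equiv.Perm (Fin n)) : Finset ℕ :=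
  {j ∈ Finset.Icc 1 (n - 1) | permVal π j > permVal π (j + 1)}

/-- `neg(π, ε)`, the number of `j` with `ε_j = -1` (also the color sum `c_1 + ⋯ + c_n`). -/
def negCount {n : ℕ} (g : SignedPerm n) : ℕ := ∑ j ∈ Finset.Icc 1 n, color g.2 j

/-- The relation `π(j)^(c_j) > π(k)^(c_k)` in the total order where `a^c < b^d` means
`c > d`, or `c = d` and `a < b`. -/
def WindowGT {n : ℕ} (g : SignedPerm n) (j k : ℕ) : Prop :=
  color g.2 j < color g.2 k ∨ (color g.2 j = color g.2 k ∧ permVal g.1 k < permVal g.1 j)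

instance {n : ℕ} (g : SignedPerm n) (j k : ℕ) : Decidable (WindowGT g j k) := by
  unfold WindowGT; infer_instance

/-- `Des(π, ε)`, a subset of `{0, …, n-1}`. -/
def windowDes {n : ℕ} (g : SignedPerm n) : Finset ℕ :=
  {j ∈ Finset.range n | WindowGT g j (j + 1)}

/-- The type-`A` descent set `Des_A(π, ε)`, a subset of `[n-1]`. -/
def windowDesA {n : ℕ} (g : SignedPerm n) : Finset ℕ :=
  {j ∈ Finset.Icc 1 (n - 1) | WindowGT g j (j + 1)}

/-- `fmajor(π, ε) = 2 ∑_{j ∈ Des_A(π, ε)} j + neg(π, ε)`. -/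
def fmajor {n : ℕ} (g : SignedPerm n) : ℕ := 2 * (∑ j ∈ windowDesA g, j) + negCount g

/-- The integer `ε_j π(j)`, with `ε_0 π(0) = 0`. -/
def signedVal {n : ℕ} (g : SignedPerm n) (j : ℕ) : ℤ := (signVal g.2 j : ℤ) * (permVal g.1 j : ℤ)

/-- `NatDes(π, ε) = {j ∈ {0, …, n-1} : ε_j π(j) > ε_{j+1} π(j+1)}`. -/
def natDes {n : ℕ} (g : SignedPerm n) : Finset ℕ :=
  {j ∈ Finset.range n | signedVal g j > signedVal g (j + 1)}

/-- `NatDes_A(π, ε) = {j ∈ [n-1] : ε_j π(j) > ε_{j+1} π(j+1)}`. -/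
def natDesA {n : ℕ} (g : SignedPerm n) : Finset ℕ :=
  {j ∈ Finset.Icc 1 (n - 1) | signedVal g j > signedVal g (j + 1)}

/-- `natfmaj(π, ε) = 2 ∑_{j ∈ NatDes_A(π, ε)} j + neg(π, ε)`. -/
def natfmaj {n : ℕ} (g : SignedPerm n) : ℕ := 2 * (∑ j ∈ natDesA g, j) + negCount g

/-- The reciprocal `1 / f` of a formal power series `f` with constant coefficient `1`; see
`mul_recip`. -/
noncomputable def recip {A : Type*} [CommRing A] (f : PowerSeries A) : PowerSeries A :=
  PowerSeries.invOfUnit f 1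

theorem mul_recip {A : Type*} [CommRing A] (f : PowerSeries A)
    (hf : PowerSeries.constantCoeff f = 1) : f * recip f = 1 :=
  PowerSeries.mul_invOfUnit f 1 (by simpa using hf)

/-- The product `z_{π(1)} z_{π(2)} ⋯ z_{π(j)}` in `R[z_1, …, z_n]`. -/
noncomputable def prefixProd (R : Type*) [CommRing R] {n : ℕ} (π : Equiv.Perm (Fin n)) (j : ℕ) :
    MvPolynomial (Fin n) R :=
  ∏ i ∈ Finset.univ.filter (fun i : Fin n => i.val < j), MvPolynomial.X (π i)

/-- The denominator `∏_{j=0}^n (1 - z_0 z_{π(1)}^2 ⋯ z_{π(j)}^2)` in `R[z_1, …, z_n][[z_0]]`. -/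
noncomputable def denom (R : Type*) [CommRing R] {n : ℕ} (π : Equiv.Perm (Fin n)) :
    PowerSeries (MvPolynomial (Fin n) R) :=
  ∏ j ∈ Finset.range (n + 1), (1 - PowerSeries.X * PowerSeries.C (prefixProd R π j ^ 2))

theorem constantCoeff_denom (R : Type*) [CommRing R] {n : ℕ} (π : Equiv.Perm (Fin n)) :
    PowerSeries.constantCoeff (denom R π) = 1 := by
  simp [denom, map_prod]

/-- The numerator of the summand of `(π, ε)` in `R[z_1, …, z_n][[z_0]]`. -/
noncomputable def numer (R : Type*) [CommRing R] {n : ℕ} (g : SignedPerm n) :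
    PowerSeries (MvPolynomial (Fin n) R) :=
  PowerSeries.X ^ ⌈(totalColorChange g.2 : ℚ) / 2⌉₊ *
    (∏ j ∈ Finset.Icc 1 n with colorChange g.2 j = 1, PowerSeries.C (prefixProd R g.1 j)) *
    (∏ j ∈ permDes g.1 with colorChange g.2 j = 0,
      PowerSeries.X * PowerSeries.C (prefixProd R g.1 j ^ 2))

/-! The coefficient of `z_0^k` on the left enumerates the vectors `f : [n] → {0, …, 2k}` by the
monomial `∏ z_i^{f i}`. Sort `f` into weakly decreasing order, ties by increasing letter, and record
the parities of the sorted entries as signs: this is `sortingData f = (π, ε)`. In a fibre, the gap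
between consecutive sorted entries (with a final 0) is odd at a color change and even elsewhere, and
at least 2 at a descent of `π` without color change. So the gaps are `minGap` plus arbitrary even
numbers `2 e_j` (`sortingData_eq_iff_gaps`), and the fibre is enumerated by the summand of `(π, ε)`
(`coeff_numer_mul_recip_denom`). For the bijection, reversing the relative order of the negative
letters turns the window order into the natural order of integers (`signedVal_reverseNeg_gt_iff`).
For the last identity, set all `z_i = q`: the numerator becomes `t^des q^fmajor` (`card_windowDes`,
`fmajor_eq`), and the bijection transfers the sum to `(natdes, natfmaj)`. -/

/-! ### Colors and permutation values, with boundary conventions. -/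

theorem color_le_one {n : ℕ} (ε : Fin n → ℤˣ) (j : ℕ) : color ε j ≤ 1 := by
  unfold color; split <;> omega

theorem color_of_lt {n : ℕ} (ε : Fin n → ℤˣ) {j : ℕ} (h : n < j) : color ε j = 0 := by
  have : ¬ (1 ≤ j ∧ j ≤ n) := by omega
  simp [color, signVal, this]

theorem color_succ {n : ℕ} (ε : Fin n → ℤˣ) (i : Fin n) :
    color ε (i + 1) = if ε i = 1 then 0 else 1 := by
  have : 1 ≤ (i : ℕ) + 1 ∧ (i : ℕ) + 1 ≤ n := by omega
  simp [color, signVal]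

theorem permVal_succ {n : ℕ} (π : Equiv.Perm (Fin n)) (i : Fin n) :
    permVal π (i + 1) = π i + 1 := by
  have : 1 ≤ (i : ℕ) + 1 ∧ (i : ℕ) + 1 ≤ n := by omega
  simp [permVal]

theorem permVal_of_lt {n : ℕ} (π : Equiv.Perm (Fin n)) {j : ℕ} (h : n < j) :
    permVal π j = j := by
  have : ¬ (1 ≤ j ∧ j ≤ n) := by omega
  simp [permVal, this]

theorem permVal_le {n : ℕ} (π : Equiv.Perm (Fin n)) {j : ℕ} (hj : j ≤ n) : permVal π j ≤ n := by
  unfold permVal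
  split
  · omega
  · exact hj

theorem permVal_injective {n : ℕ} (π : Equiv.Perm (Fin n)) : Function.Injective (permVal π) := by
  intro i j h
  unfold permVal at h
  split at h <;> split at h
  · have := π.injective (Fin.ext (Nat.succ_injective h))
    simp only [Fin.mk.injEq] at this
    omega
  all_goals omega

/-- The convention `π(n+1) = n+1` rules out a descent at `n`, so the last position needs no separate
treatment. -/
theorem mem_permDes {n : ℕ} (π : Equiv.Perm (Fin n)) (j : ℕ) :
    j ∈ permDes π ↔ 1 ≤ j ∧ j ≤ n ∧ permVal π (j + 1) < permVal π j := by
  simp only [permDes, Finset.mem_filter, Finset.mem_Icc]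
  constructor
  · rintro ⟨⟨h1, h2⟩, h3⟩
    exact ⟨h1, by omega, h3⟩
  · rintro ⟨h1, h2, h3⟩
    refine ⟨⟨h1, ?_⟩, h3⟩
    rcases h2.lt_or_eq with h | rfl
    · omega
    · have := permVal_le π le_rfl
      rw [permVal_of_lt π (Nat.lt_succ_self _)] at h3
      omega

theorem colorChange_eq {n : ℕ} (ε : Fin n → ℤˣ) (j : ℕ) :
    colorChange ε j = if color ε j = color ε (j + 1) then 0 else 1 := by
  have h1 := color_le_one ε j
  have h2 := color_le_one ε (j + 1)
  unfold colorChange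
  split <;> omega

/-! ### Sorting a vector and the gaps between its sorted entries. -/

/-- The positions counted by the last product in the numerator of the summand of `g`. -/
def plainDes {n : ℕ} (g : SignedPerm n) : Finset ℕ := {j ∈ permDes g.1 | colorChange g.2 j = 0}

theorem plainDes_subset {n : ℕ} (g : SignedPerm n) : plainDes g ⊆ Finset.Icc 1 n := by
  intro j hj
  have := (mem_permDes g.1 j).1 (Finset.mem_filter.1 hj).1
  exact Finset.mem_Icc.2 ⟨this.1, this.2.1⟩

/-- The smallest difference of two consecutive entries, at the positions `j` and `j + 1`, of the
weakly decreasing rearrangement of a vector with sorting data `g`. -/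
def minGap {n : ℕ} (g : SignedPerm n) (j : ℕ) : ℕ :=
  colorChange g.2 j + if j ∈ plainDes g then 2 else 0

theorem sum_minGap {n : ℕ} (g : SignedPerm n) :
    ∑ j ∈ Finset.Icc 1 n, minGap g j = totalColorChange g.2 + 2 * (plainDes g).card := by
  simp only [minGap, Finset.sum_add_distrib, totalColorChange, Finset.sum_ite_mem,
    Finset.inter_eq_right.2 (plainDes_subset g), Finset.sum_const, smul_eq_mul, mul_comm]

/-- The word `f(π(1)), …, f(π(n))`, extended by zeros. -/
def permutedWord {n : ℕ} (π : Equiv.Perm (Fin n)) (f : Fin n → ℕ) (j : ℕ) : ℕ :=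
  if h : 1 ≤ j ∧ j ≤ n then f (π ⟨j - 1, by omega⟩) else 0

theorem permutedWord_succ {n : ℕ} (π : Equiv.Perm (Fin n)) (f : Fin n → ℕ) (i : Fin n) :
    permutedWord π f (i + 1) = f (π i) := by
  have : 1 ≤ (i : ℕ) + 1 ∧ (i : ℕ) + 1 ≤ n := by omega
  simp [permutedWord]

theorem permutedWord_of_lt {n : ℕ} (π : Equiv.Perm (Fin n)) (f : Fin n → ℕ) {j : ℕ}
    (h : n < j) : permutedWord π f j = 0 := by
  have : ¬ (1 ≤ j ∧ j ≤ n) := by omega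
  simp [permutedWord, this]

theorem exists_fin_succ {n j : ℕ} (h1 : 1 ≤ j) (hn : j ≤ n) : ∃ i : Fin n, j = i + 1 :=
  ⟨⟨j - 1, by omega⟩, by simp; omega⟩

/-- The permutation sorting `f` into weakly decreasing order, equal entries being kept in their
order, with the parities of the sorted entries. -/
noncomputable def sortingData {n : ℕ} (f : Fin n → ℕ) : SignedPerm n :=
  (Tuple.sort (OrderDual.toDual ∘ f), fun j => (-1) ^ f (Tuple.sort (OrderDual.toDual ∘ f) j))

theorem sortingData_eq_iff {n : ℕ} (f : Fin n → ℕ) (g : SignedPerm n) :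
    sortingData f = g ↔
      (∀ i j : Fin n, i < j → f (g.1 j) < f (g.1 i) ∨ (f (g.1 i) = f (g.1 j) ∧ g.1 i < g.1 j)) ∧
      ∀ i : Fin n, color g.2 (i + 1) = f (g.1 i) % 2 := by
  obtain ⟨π, ε⟩ := g
  have key : sortingData f = (π, ε) ↔
      π = Tuple.sort (OrderDual.toDual ∘ f) ∧ ∀ i, ε i = (-1) ^ f (π i) := by
    rw [sortingData, Prod.mk.injEq, funext_iff]
    constructor
    · rintro ⟨rfl, h⟩
      exact ⟨rfl, fun i => (h i).symm⟩
    · rintro ⟨rfl, h⟩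
      exact ⟨rfl, fun i => (h i).symm⟩
  rw [key, Tuple.eq_sort_iff]
  refine and_congr ?_ (forall_congr' fun i => ?_)
  · constructor
    · rintro ⟨h1, h2⟩ i j hij
      have h : f (π j) ≤ f (π i) := h1 hij.le
      rcases h.lt_or_eq with h | h
      · exact Or.inl h
      · exact Or.inr ⟨h.symm, h2 i j hij (congrArg OrderDual.toDual h.symm)⟩
    · intro h
      refine ⟨fun i j hij => ?_, fun i j hij he => ?_⟩
      · change f (π j) ≤ f (π i)
        rcases hij.lt_or_eq with hij | rfl
        · rcases h i j hij with h | h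
          · exact h.le
          · exact h.1.ge
        · exact le_rfl
      · have he : f (π i) = f (π j) := he
        rcases h i j hij with h | h
        · exact absurd he h.ne'
        · exact h.2
  · rw [color_succ]
    rcases Nat.even_or_odd (f (π i)) with h | h
    · rw [h.neg_one_pow, Nat.even_iff.1 h]
      simp
    · rw [h.neg_one_pow, Nat.odd_iff.1 h]
      rcases Int.units_eq_one_or (ε i) with h | h <;> simp [h]

/-- Colors are parities, so `minGap` has the parity of the gap; tie-breaking forces a strict drop at
a descent, hence a drop of at least 2 if the color stays the same. Conversely, the gaps determine
all parities and allow ties only where `π` ascends. -/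
theorem sortingData_eq_iff_gaps {n : ℕ} (f : Fin n → ℕ) (g : SignedPerm n) :
    sortingData f = g ↔ ∃ e : ℕ → ℕ, ∀ j, 1 ≤ j → j ≤ n →
      permutedWord g.1 f j = permutedWord g.1 f (j + 1) + (minGap g j + 2 * e j) := by
  rw [sortingData_eq_iff]
  constructor
  · rintro ⟨h1, h2⟩
    have hc : ∀ j, 1 ≤ j → color g.2 j = permutedWord g.1 f j % 2 := by
      intro j hj
      by_cases hn : j ≤ n
      · obtain ⟨i, rfl⟩ := exists_fin_succ hj hn
        rw [h2, permutedWord_succ]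
      · rw [color_of_lt _ (by omega), permutedWord_of_lt _ _ (by omega)]
    refine ⟨fun j => (permutedWord g.1 f j - permutedWord g.1 f (j + 1) - minGap g j) / 2,
      fun j hj hn => ?_⟩
    have hr : permutedWord g.1 f (j + 1) < permutedWord g.1 f j ∨
        (permutedWord g.1 f j = permutedWord g.1 f (j + 1) ∧ j ∉ plainDes g) := by
      have hd : j ∈ plainDes g → permVal g.1 (j + 1) < permVal g.1 j := fun h =>
        ((mem_permDes g.1 j).1 (Finset.mem_filter.1 h).1).2.2
      rcases hn.lt_or_eq with hlt | rfl
      · obtain ⟨i, rfl⟩ := exists_fin_succ hj hn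
        obtain ⟨i', hi'⟩ := exists_fin_succ (n := n) (j := i + 1 + 1) (by omega) (by omega)
        have hii : i < i' := Fin.lt_def.2 (by omega)
        rw [hi', permutedWord_succ, permutedWord_succ]
        rw [hi', permVal_succ, permVal_succ] at hd
        rcases h1 i i' hii with h | ⟨h, h'⟩
        · exact Or.inl h
        · refine Or.inr ⟨h, fun hm => ?_⟩
          have := hd hm
          have := Fin.lt_def.1 h'
          omega
      · have := permVal_le g.1 (le_refl j)
        rw [permVal_of_lt g.1 (Nat.lt_succ_self j)] at hd
        rw [permutedWord_of_lt _ _ (Nat.lt_succ_self j)]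
        rcases Nat.eq_zero_or_pos (permutedWord g.1 f j) with h | h
        · exact Or.inr ⟨h, fun hm => by have := hd hm; omega⟩
        · exact Or.inl h
    have hp : j ∈ plainDes g → colorChange g.2 j = 0 := fun h => (Finset.mem_filter.1 h).2
    have c1 := hc j hj
    have c2 := hc (j + 1) (by omega)
    have hcc := colorChange_eq g.2 j
    simp only [minGap]
    by_cases hm : j ∈ plainDes g
    · have hr : permutedWord g.1 f (j + 1) < permutedWord g.1 f j := by tauto
      have := hp hm
      rw [this] at hcc ⊢
      simp only [hm, if_true]
      split at hcc <;> omega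
    · simp only [hm, if_false]
      split at hcc <;> omega
  · rintro ⟨e, he⟩
    have hr : ∀ j, 1 ≤ j → permutedWord g.1 f (j + 1) < permutedWord g.1 f j ∨
        (permutedWord g.1 f j = permutedWord g.1 f (j + 1) ∧
          permVal g.1 j < permVal g.1 (j + 1)) := by
      intro j hj
      by_cases hn : j ≤ n
      · have h := he j hj hn
        -- Otherwise `j` is a descent of `π` with gap 0; but at a descent `minGap` is 1 or 2.
        by_contra hcon
        push Not at hcon
        have hle : permVal g.1 (j + 1) ≤ permVal g.1 j := hcon.2 (by omega)
        have hne := (permVal_injective g.1).ne (Nat.succ_ne_self j)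
        rw [Nat.succ_eq_add_one] at hne
        have hdes : j ∈ permDes g.1 := (mem_permDes g.1 j).2 ⟨hj, hn, by omega⟩
        have h0 : minGap g j = 0 := by omega
        simp only [minGap, plainDes, Finset.mem_filter, hdes, true_and] at h0
        split at h0 <;> omega
      · right
        rw [permutedWord_of_lt _ _ (by omega), permutedWord_of_lt _ _ (by omega),
          permVal_of_lt _ (by omega), permVal_of_lt _ (by omega)]
        omega
    have hlt : ∀ j k, 1 ≤ j → j < k → permutedWord g.1 f k < permutedWord g.1 f j ∨
        (permutedWord g.1 f j = permutedWord g.1 f k ∧ permVal g.1 j < permVal g.1 k) := by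
      intro j k hj hjk
      induction k, hjk using Nat.le_induction with
      | base => exact hr j hj
      | succ k hk ih =>
        have := hr k (by omega)
        omega
    refine ⟨fun i j hij => ?_, fun i => ?_⟩
    · have := hlt (i + 1) (j + 1) (by omega) (by have := Fin.lt_def.1 hij; omega)
      rw [permutedWord_succ, permutedWord_succ, permVal_succ, permVal_succ] at this
      rw [Fin.lt_def]
      omega
    -- Downward induction on the position, starting beyond `n`, where color and word both vanish.
    · have hc : ∀ m j, 1 ≤ j → n + 1 ≤ j + m → color g.2 j = permutedWord g.1 f j % 2 := by
        intro m
        induction m with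
        | zero =>
          intro j _ hn
          rw [color_of_lt _ (by omega), permutedWord_of_lt _ _ (by omega)]
        | succ m ih =>
          intro j hj hn
          by_cases hjn : j ≤ n
          · have h1 := ih (j + 1) (by omega) (by omega)
            have h2 := he j hj hjn
            have hcc := colorChange_eq g.2 j
            have c1 := color_le_one g.2 j
            have c2 := color_le_one g.2 (j + 1)
            simp only [minGap] at h2
            split at h2 <;> split at hcc <;> omega
          · rw [color_of_lt _ (by omega), permutedWord_of_lt _ _ (by omega)]
      rw [hc n (i + 1) (by omega) (by omega), permutedWord_succ]

/-! ### Parametrization of the fibres of `sortingData`. -/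

/-- The vector with sorting data `g` whose consecutive differences exceed the smallest possible
ones by `2 e`. -/
def ofGaps {n : ℕ} (g : SignedPerm n) (e : ℕ → ℕ) (i : Fin n) : ℕ :=
  ∑ l ∈ Finset.Icc ((g.1.symm i : ℕ) + 1) n, (minGap g l + 2 * e l)

theorem permutedWord_ofGaps {n : ℕ} (g : SignedPerm n) (e : ℕ → ℕ) {j : ℕ} (hj : 1 ≤ j) :
    permutedWord g.1 (ofGaps g e) j = ∑ l ∈ Finset.Icc j n, (minGap g l + 2 * e l) := by
  by_cases hn : j ≤ n
  · obtain ⟨i, rfl⟩ := exists_fin_succ hj hn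
    rw [permutedWord_succ]
    simp [ofGaps]
  · rw [permutedWord_of_lt _ _ (by omega), Finset.Icc_eq_empty (by omega), Finset.sum_empty]

theorem eq_ofGaps {n : ℕ} (f : Fin n → ℕ) (g : SignedPerm n) (e : ℕ → ℕ)
    (he : ∀ j, 1 ≤ j → j ≤ n →
      permutedWord g.1 f j = permutedWord g.1 f (j + 1) + (minGap g j + 2 * e j)) :
    f = ofGaps g e := by
  have hw : ∀ m j, 1 ≤ j → n + 1 ≤ j + m →
      permutedWord g.1 f j = ∑ l ∈ Finset.Icc j n, (minGap g l + 2 * e l) := by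
    intro m
    induction m with
    | zero =>
      intro j _ hn
      rw [permutedWord_of_lt _ _ (by omega), Finset.Icc_eq_empty (by omega), Finset.sum_empty]
    | succ m ih =>
      intro j hj hn
      by_cases hjn : j ≤ n
      · rw [he j hj hjn, ih (j + 1) (by omega) (by omega),
          ← Finset.insert_Icc_add_one_left_eq_Icc hjn, Finset.sum_insert (by simp), add_comm]
      · rw [permutedWord_of_lt _ _ (by omega), Finset.Icc_eq_empty (by omega), Finset.sum_empty]
  funext i
  have := hw n (g.1.symm i + 1) (by omega) (by omega)
  rwa [permutedWord_succ, Equiv.apply_symm_apply] at this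

theorem sortingData_ofGaps {n : ℕ} (g : SignedPerm n) (e : ℕ → ℕ) :
    sortingData (ofGaps g e) = g := by
  refine (sortingData_eq_iff_gaps _ _).2 ⟨e, fun j hj hn => ?_⟩
  rw [permutedWord_ofGaps g e hj, permutedWord_ofGaps g e (by omega),
    ← Finset.insert_Icc_add_one_left_eq_Icc hn, Finset.sum_insert (by simp), add_comm]

theorem sortingData_eq_iff_exists_ofGaps {n : ℕ} (f : Fin n → ℕ) (g : SignedPerm n) :
    sortingData f = g ↔ ∃ e : ℕ → ℕ, ofGaps g e = f := by
  constructor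
  · intro h
    obtain ⟨e, he⟩ := (sortingData_eq_iff_gaps f g).1 h
    exact ⟨e, (eq_ofGaps f g e he).symm⟩
  · rintro ⟨e, rfl⟩
    exact sortingData_ofGaps g e

theorem ofGaps_inj {n : ℕ} (g : SignedPerm n) {e e' : ℕ → ℕ} (h : ofGaps g e = ofGaps g e')
    {j : ℕ} (hj : 1 ≤ j) (hn : j ≤ n) : e j = e' j := by
  have h1 := permutedWord_ofGaps g e hj
  have h2 := permutedWord_ofGaps g e (j := j + 1) (by omega)
  have h3 := permutedWord_ofGaps g e' hj
  have h4 := permutedWord_ofGaps g e' (j := j + 1) (by omega)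
  rw [← Finset.insert_Icc_add_one_left_eq_Icc hn, Finset.sum_insert (by simp)] at h1 h3
  rw [h] at h1 h2
  omega

/-- The exponent of `z_0` in the numerator of the summand of `g`. -/
def minLevel {n : ℕ} (g : SignedPerm n) : ℕ :=
  (totalColorChange g.2 + 1) / 2 + (plainDes g).card

/-- For `n > 0` the largest entry is the sum of all gaps, `ch(ε) + 2 |plainDes g| + 2 ∑ e`. Halving
the bound `2k` rounds `ch(ε) / 2` up. -/
theorem ofGaps_le_iff {n : ℕ} (g : SignedPerm n) (e : ℕ → ℕ) (k : ℕ) :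
    (∀ i, ofGaps g e i ≤ 2 * k) ↔ minLevel g + ∑ l ∈ Finset.Icc 1 n, e l ≤ k := by
  have hs : ∑ l ∈ Finset.Icc 1 n, (minGap g l + 2 * e l) =
      totalColorChange g.2 + 2 * (plainDes g).card + 2 * ∑ l ∈ Finset.Icc 1 n, e l := by
    rw [Finset.sum_add_distrib, sum_minGap, Finset.mul_sum]
  constructor
  · intro h
    have : ∑ l ∈ Finset.Icc 1 n, (minGap g l + 2 * e l) ≤ 2 * k := by
      rcases Nat.eq_zero_or_pos n with rfl | hn
      · simp
      · simpa [ofGaps] using h (g.1 ⟨0, hn⟩)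
    rw [minLevel]
    omega
  · intro h i
    have : ofGaps g e i ≤ ∑ l ∈ Finset.Icc 1 n, (minGap g l + 2 * e l) :=
      Finset.sum_le_sum_of_subset (Finset.Icc_subset_Icc_left (by omega))
    rw [minLevel] at h
    omega

/-! ### Generating functions of the fibres and the multivariate identity. -/

theorem eq_recip {A : Type*} [CommRing A] {f a : PowerSeries A}
    (hf : PowerSeries.constantCoeff f = 1) (h : f * a = 1) : a = recip f := by
  calc a = a * (f * recip f) := by rw [mul_recip f hf, mul_one]
    _ = recip f := by rw [← mul_assoc, mul_comm a, h, one_mul]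

theorem one_sub_X_mul_C_mul_mk_pow {A : Type*} [CommRing A] (a : A) :
    (1 - PowerSeries.X * PowerSeries.C a) * PowerSeries.mk (fun k => a ^ k) = 1 := by
  ext k
  rw [sub_mul, one_mul, mul_assoc, map_sub, PowerSeries.coeff_one]
  cases k with
  | zero => simp
  | succ k => simp [PowerSeries.coeff_succ_X_mul, pow_succ']

theorem recip_denom (R : Type*) [CommRing R] {n : ℕ} (π : Equiv.Perm (Fin n)) :
    recip (denom R π) = ∏ j ∈ Finset.range (n + 1),
      PowerSeries.mk (fun k => (prefixProd R π j ^ 2) ^ k) := by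
  refine (eq_recip (constantCoeff_denom R π) ?_).symm
  rw [denom, ← Finset.prod_mul_distrib]
  exact Finset.prod_eq_one fun j _ => one_sub_X_mul_C_mul_mk_pow _

theorem ceil_half (m : ℕ) : ⌈(m : ℚ) / 2⌉₊ = (m + 1) / 2 := by
  obtain ⟨c, rfl | rfl⟩ := Nat.even_or_odd' m
  · rw [show ((2 * c : ℕ) : ℚ) / 2 = c by push_cast; ring, Nat.ceil_natCast]
    omega
  · rw [show (2 * c + 1 + 1) / 2 = c + 1 by omega, Nat.ceil_eq_iff (Nat.succ_ne_zero c)]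
    push_cast
    constructor <;> linarith

theorem numer_eq (R : Type*) [CommRing R] {n : ℕ} (g : SignedPerm n) :
    numer R g = PowerSeries.X ^ minLevel g *
      PowerSeries.C (∏ j ∈ Finset.Icc 1 n, prefixProd R g.1 j ^ minGap g j) := by
  have h1 : ∏ j ∈ Finset.Icc 1 n with colorChange g.2 j = 1, prefixProd R g.1 j =
      ∏ j ∈ Finset.Icc 1 n, prefixProd R g.1 j ^ colorChange g.2 j := by
    rw [Finset.prod_filter]
    refine Finset.prod_congr rfl fun j _ => ?_
    rw [colorChange_eq]
    split_ifs <;> simp_all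
  have h2 : ∏ j ∈ plainDes g, prefixProd R g.1 j ^ 2 =
      ∏ j ∈ Finset.Icc 1 n, prefixProd R g.1 j ^ (if j ∈ plainDes g then 2 else 0) := by
    rw [← Finset.prod_subset (plainDes_subset g) (fun j _ hj => by simp [hj])]
    exact Finset.prod_congr rfl fun j hj => by simp [hj]
  change _ * _ * ∏ j ∈ plainDes g, _ = _
  rw [Finset.prod_mul_distrib, Finset.prod_const, ← map_prod, ← map_prod, h1, h2, ceil_half]
  simp only [minGap, minLevel, pow_add, Finset.prod_mul_distrib, map_mul]
  ring

/-- The variable `z_i` divides the prefix product of length `j` exactly when the position of `i` is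
at most `j`; its exponent is thus a tail sum, as in `ofGaps`. -/
theorem prod_prefixProd_pow (R : Type*) [CommRing R] {n : ℕ} (π : Equiv.Perm (Fin n))
    (d : ℕ → ℕ) :
    ∏ j ∈ Finset.Icc 1 n, prefixProd R π j ^ d j =
      ∏ i : Fin n, MvPolynomial.X i ^ ∑ l ∈ Finset.Icc ((π.symm i : ℕ) + 1) n, d l := by
  rw [← Equiv.prod_comp π]
  simp only [prefixProd, ← Finset.prod_pow, ← Finset.prod_pow_eq_pow_sum, Equiv.symm_apply_apply]
  refine Finset.prod_comm' fun j i => ?_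
  simp only [Finset.mem_Icc, Finset.mem_filter, Finset.mem_univ, true_and, and_true]
  omega

theorem sum_range_succ_eq_sum_Icc {M : Type*} [AddCommMonoid M] (F : ℕ → M) (n : ℕ) :
    ∑ j ∈ Finset.range (n + 1), F j = F 0 + ∑ j ∈ Finset.Icc 1 n, F j := by
  rw [Finset.range_eq_Ico, Finset.sum_eq_sum_Ico_succ_bot (Nat.succ_pos n)]
  rfl

/-- Expanding the geometric series gives a sum over `(e_0, …, e_n)` of total `k - minLevel g`. Here
`e_1, …, e_n` are the excess half-gaps, and `e_0` is the slack in the bound `2k`. -/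
theorem coeff_numer_mul_recip_denom (R : Type*) [CommRing R] {n : ℕ} (g : SignedPerm n) (k : ℕ) :
    PowerSeries.coeff k (numer R g * recip (denom R g.1)) =
      ∑ f ∈ Fintype.piFinset (fun _ : Fin n => Finset.range (2 * k + 1)) with sortingData f = g,
        ∏ i, MvPolynomial.X i ^ f i := by
  have hrange : ∀ e : ℕ → ℕ, ∑ j ∈ Finset.range (n + 1), e j =
      e 0 + ∑ j ∈ Finset.Icc 1 n, e j := fun e => sum_range_succ_eq_sum_Icc e n
  rw [numer_eq, mul_assoc, PowerSeries.coeff_X_pow_mul', recip_denom]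
  split_ifs with hk
  · rw [PowerSeries.coeff_C_mul, PowerSeries.coeff_prod, Finset.mul_sum]
    simp only [PowerSeries.coeff_mk]
    refine Finset.sum_bij (fun e _ => ofGaps g e) (fun e he => ?_) (fun e he e' he' h => ?_)
      (fun f hf => ?_) (fun e he => ?_)
    · obtain ⟨hs, -⟩ := Finset.mem_finsuppAntidiag.1 he
      rw [hrange] at hs
      have := (ofGaps_le_iff g e k).2 (by omega)
      simp only [Finset.mem_filter, Fintype.mem_piFinset, Finset.mem_range]
      exact ⟨fun i => Nat.lt_succ_of_le (this i), sortingData_ofGaps g e⟩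
    · obtain ⟨hs, hsupp⟩ := Finset.mem_finsuppAntidiag.1 he
      obtain ⟨hs', hsupp'⟩ := Finset.mem_finsuppAntidiag.1 he'
      have hpos : ∀ j, 1 ≤ j → j ≤ n → e j = e' j := fun j => ofGaps_inj g h
      have hsum : (Finset.Icc 1 n).sum e = (Finset.Icc 1 n).sum e' :=
        Finset.sum_congr rfl fun j hj => hpos j (Finset.mem_Icc.1 hj).1 (Finset.mem_Icc.1 hj).2
      have h0 : e 0 = e' 0 := by
        refine Nat.add_right_cancel (m := (Finset.Icc 1 n).sum e') ?_
        calc _ = (Finset.range (n + 1)).sum e := by rw [← hsum]; exact (hrange e).symm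
          _ = (Finset.range (n + 1)).sum e' := hs.trans hs'.symm
          _ = _ := hrange e'
      ext j
      rcases Nat.eq_zero_or_pos j with rfl | hj
      · exact h0
      · by_cases hn : j ≤ n
        · exact hpos j hj hn
        · have hnm : j ∉ Finset.range (n + 1) := by simp; omega
          rw [Finsupp.notMem_support_iff.1 fun hm => hnm (hsupp hm),
            Finsupp.notMem_support_iff.1 fun hm => hnm (hsupp' hm)]
    · simp only [Finset.mem_filter, Fintype.mem_piFinset, Finset.mem_range] at hf
      obtain ⟨e, rfl⟩ := (sortingData_eq_iff_exists_ofGaps f g).1 hf.2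
      have hle := (ofGaps_le_iff g e k).1 fun i => Nat.le_of_lt_succ (hf.1 i)
      -- The gaps leave `e` free outside `1, …, n`: the value at 0 is set to the slack, and all
      -- values beyond `n` to 0.
      let e' : ℕ → ℕ := fun j =>
        if j = 0 then k - minLevel g - (Finset.Icc 1 n).sum e else if j ≤ n then e j else 0
      have he' : ∀ j ∈ Finset.Icc 1 n, e' j = e j := by
        intro j hj
        have := Finset.mem_Icc.1 hj
        simp only [e', if_neg (show j ≠ 0 by omega), if_pos this.2]
      refine ⟨Finsupp.onFinset (Finset.range (n + 1)) e' fun j hj => ?_, ?_, ?_⟩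
      · by_contra hcon
        rw [Finset.mem_range] at hcon
        exact hj (by simp only [e', if_neg (show j ≠ 0 by omega), if_neg (show ¬ j ≤ n by omega)])
      · refine Finset.mem_finsuppAntidiag.2 ⟨?_, Finsupp.support_onFinset_subset⟩
        rw [hrange]
        simp only [Finsupp.onFinset_apply]
        rw [Finset.sum_congr rfl he']
        change k - minLevel g - (Finset.Icc 1 n).sum e + (Finset.Icc 1 n).sum e = k - minLevel g
        have hle : minLevel g + (Finset.Icc 1 n).sum e ≤ k := hle
        omega
      · funext i
        refine Finset.sum_congr rfl fun l hl => ?_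
        rw [Finsupp.onFinset_apply, he' l (Finset.Icc_subset_Icc_left (by omega) hl)]
    · rw [Finset.range_eq_Ico, Finset.prod_eq_prod_Ico_succ_bot (by omega)]
      have h0 : prefixProd R g.1 0 = 1 := by simp [prefixProd]
      rw [h0, one_pow, one_pow, one_mul]
      change _ * ∏ j ∈ Finset.Icc 1 n, _ = _
      rw [← Finset.prod_mul_distrib]
      simp only [← pow_mul, ← pow_add]
      exact prod_prefixProd_pow R g.1 _
  -- Below `minLevel g` the fibre has no vector bounded by `2k`.
  · symm
    refine Finset.sum_eq_zero fun f hf => absurd ?_ hk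
    simp only [Finset.mem_filter, Fintype.mem_piFinset, Finset.mem_range] at hf
    obtain ⟨e, rfl⟩ := (sortingData_eq_iff_exists_ofGaps f g).1 hf.2
    have := (ofGaps_le_iff g e k).1 fun i => Nat.le_of_lt_succ (hf.1 i)
    omega

theorem mk_prod_qNumber_eq (R : Type*) [CommRing R] (n : ℕ) :
    PowerSeries.mk (fun k : ℕ =>
        ∏ j : Fin n, qNumber (2 * k + 1) (MvPolynomial.X j : MvPolynomial (Fin n) R)) =
      ∑ g : SignedPerm n, numer R g * recip (denom R g.1) := by
  ext1 k
  simp only [map_sum, coeff_numer_mul_recip_denom, PowerSeries.coeff_mk, qNumber]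
  rw [Finset.sum_fiberwise, Finset.prod_univ_sum]

/-! ### The bijection reversing the negative letters. -/

/-- The permutation that reverses the order of the elements of `S` and fixes all other points. -/
def reverseOn {n : ℕ} (S : Finset (Fin n)) : Equiv.Perm (Fin n) :=
  Equiv.Perm.ofSubtype (((S.orderIsoOfFin rfl).toEquiv).permCongr Fin.revPerm)

theorem reverseOn_of_notMem {n : ℕ} {S : Finset (Fin n)} {x : Fin n} (hx : x ∉ S) :
    reverseOn S x = x :=
  Equiv.Perm.ofSubtype_apply_of_not_mem _ hx

theorem reverseOn_of_mem {n : ℕ} {S : Finset (Fin n)} {x : Fin n} (hx : x ∈ S) :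
    reverseOn S x = S.orderIsoOfFin rfl ((S.orderIsoOfFin rfl).symm ⟨x, hx⟩).rev := by
  rw [reverseOn, Equiv.Perm.ofSubtype_apply_of_mem _ hx]
  rfl

theorem reverseOn_mem {n : ℕ} {S : Finset (Fin n)} {x : Fin n} (hx : x ∈ S) :
    reverseOn S x ∈ S := by
  rw [reverseOn_of_mem hx]
  exact Subtype.coe_prop _

theorem reverseOn_lt_iff {n : ℕ} {S : Finset (Fin n)} {x y : Fin n} (hx : x ∈ S) (hy : y ∈ S) :
    reverseOn S x < reverseOn S y ↔ y < x := by
  rw [reverseOn_of_mem hx, reverseOn_of_mem hy, Subtype.coe_lt_coe, OrderIso.lt_iff_lt,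
    Fin.rev_lt_rev, OrderIso.lt_iff_lt, Subtype.mk_lt_mk]

theorem reverseOn_reverseOn {n : ℕ} (S : Finset (Fin n)) (x : Fin n) :
    reverseOn S (reverseOn S x) = x := by
  by_cases hx : x ∈ S
  · have h := reverseOn_mem hx
    rw [reverseOn_of_mem h]
    have : (⟨reverseOn S x, h⟩ : S) =
        S.orderIsoOfFin rfl ((S.orderIsoOfFin rfl).symm ⟨x, hx⟩).rev :=
      Subtype.ext (reverseOn_of_mem hx)
    rw [this]
    simp
  · rw [reverseOn_of_notMem hx, reverseOn_of_notMem hx]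

theorem reverseOn_mem_iff {n : ℕ} (S : Finset (Fin n)) (x : Fin n) :
    reverseOn S x ∈ S ↔ x ∈ S := by
  refine ⟨fun h => ?_, reverseOn_mem⟩
  rw [← reverseOn_reverseOn S x]
  exact reverseOn_mem h

/-- The letters of sign `-1`. -/
def negLetters {n : ℕ} (g : SignedPerm n) : Finset (Fin n) := {x | g.2 (g.1.symm x) = -1}

theorem apply_mem_negLetters {n : ℕ} (g : SignedPerm n) (i : Fin n) :
    g.1 i ∈ negLetters g ↔ g.2 i = -1 := by
  simp [negLetters]

/-- Reversal of the relative order of the letters of sign `-1`. -/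
def reverseNeg {n : ℕ} (g : SignedPerm n) : SignedPerm n :=
  (g.1.trans (reverseOn (negLetters g)), g.2)

theorem reverseNeg_fst_apply {n : ℕ} (g : SignedPerm n) (i : Fin n) :
    (reverseNeg g).1 i = reverseOn (negLetters g) (g.1 i) := rfl

theorem negLetters_reverseNeg {n : ℕ} (g : SignedPerm n) :
    negLetters (reverseNeg g) = negLetters g := by
  ext x
  obtain ⟨i, rfl⟩ := (reverseNeg g).1.surjective x
  rw [apply_mem_negLetters, reverseNeg_fst_apply, reverseOn_mem_iff, apply_mem_negLetters]
  rfl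

/-- The set of negative letters is preserved, so the second reversal acts on the same set and undoes
the first. -/
theorem reverseNeg_involutive {n : ℕ} : Function.Involutive (reverseNeg (n := n)) := by
  intro g
  refine Prod.ext (Equiv.ext fun i => ?_) rfl
  rw [reverseNeg_fst_apply, negLetters_reverseNeg, reverseNeg_fst_apply, reverseOn_reverseOn]

theorem reverseNeg_apply_of_eq_one {n : ℕ} (g : SignedPerm n) {i : Fin n} (h : g.2 i = 1) :
    (reverseNeg g).1 i = g.1 i := by
  rw [reverseNeg_fst_apply, reverseOn_of_notMem]
  rw [apply_mem_negLetters, h]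
  decide

theorem reverseNeg_apply_lt_iff {n : ℕ} (g : SignedPerm n) {i j : Fin n}
    (hi : g.2 i = -1) (hj : g.2 j = -1) :
    (reverseNeg g).1 i < (reverseNeg g).1 j ↔ g.1 j < g.1 i :=
  reverseOn_lt_iff ((apply_mem_negLetters g i).2 hi) ((apply_mem_negLetters g j).2 hj)

theorem signedVal_succ {n : ℕ} (g : SignedPerm n) (i : Fin n) :
    signedVal g (i + 1) = (g.2 i : ℤ) * (g.1 i + 1) := by
  have : 1 ≤ (i : ℕ) + 1 ∧ (i : ℕ) + 1 ≤ n := by omega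
  simp [signedVal, signVal, permVal_succ]

theorem signedVal_zero {n : ℕ} (g : SignedPerm n) : signedVal g 0 = 0 := by
  simp [signedVal, permVal]

/-- The two orders differ only in comparing two negative letters, where the reversal compensates;
letters of opposite sign compare by sign alone. At `j = 0` both conditions say that the first letter
is negative. -/
theorem signedVal_reverseNeg_gt_iff {n : ℕ} (g : SignedPerm n) {j : ℕ} (hj : j < n) :
    signedVal (reverseNeg g) j > signedVal (reverseNeg g) (j + 1) ↔ WindowGT g j (j + 1) := by
  have h2 : (reverseNeg g).2 = g.2 := rfl
  rcases Nat.eq_zero_or_pos j with rfl | hpos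
  · obtain ⟨i, hi⟩ := exists_fin_succ (n := n) (j := 0 + 1) le_rfl hj
    rw [WindowGT, hi, signedVal_zero, signedVal_succ, color_succ, permVal_succ, h2]
    have hc : color g.2 0 = 0 := by simp [color, signVal]
    have hp : permVal g.1 0 = 0 := by simp [permVal]
    rw [hc, hp]
    rcases Int.units_eq_one_or (g.2 i) with h | h <;> simp [h] <;> omega
  · obtain ⟨i, rfl⟩ := exists_fin_succ hpos hj.le
    obtain ⟨i', hi'⟩ := exists_fin_succ (n := n) (j := i + 1 + 1) (by omega) hj
    rw [WindowGT, hi', signedVal_succ, signedVal_succ, color_succ, color_succ, permVal_succ,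
      permVal_succ, h2]
    rcases Int.units_eq_one_or (g.2 i) with h | h <;>
    rcases Int.units_eq_one_or (g.2 i') with h' | h'
    · rw [reverseNeg_apply_of_eq_one g h, reverseNeg_apply_of_eq_one g h']
      simp [h, h']
    · simp [h, h']
      omega
    · simp [h, h']
      omega
    · have := reverseNeg_apply_lt_iff g h h'
      rw [Fin.lt_def, Fin.lt_def] at this
      simp [h, h']
      omega

theorem natDes_reverseNeg {n : ℕ} (g : SignedPerm n) : natDes (reverseNeg g) = windowDes g :=
  Finset.filter_congr fun _ hj => signedVal_reverseNeg_gt_iff g (Finset.mem_range.1 hj)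

theorem natfmaj_reverseNeg {n : ℕ} (g : SignedPerm n) : natfmaj (reverseNeg g) = fmajor g := by
  have h : natDesA (reverseNeg g) = windowDesA g := Finset.filter_congr fun j hj =>
    signedVal_reverseNeg_gt_iff g (by have := Finset.mem_Icc.1 hj; omega)
  rw [natfmaj, fmajor, h]
  rfl

/-! ### Descent statistics in terms of minimal gaps. -/

/-- The positions before the blocks of sign `-1`. -/
def colorAscents {n : ℕ} (ε : Fin n → ℤˣ) : Finset ℕ :=
  {j ∈ Finset.range n | color ε j < color ε (j + 1)}

theorem mem_windowDes {n : ℕ} (g : SignedPerm n) (j : ℕ) :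
    j ∈ windowDes g ↔ j < n ∧ WindowGT g j (j + 1) := by
  simp [windowDes]

theorem windowDes_eq_union {n : ℕ} (g : SignedPerm n) :
    windowDes g = colorAscents g.2 ∪ plainDes g := by
  ext j
  simp only [mem_windowDes, colorAscents, plainDes, permDes, WindowGT, Finset.mem_union,
    Finset.mem_filter, Finset.mem_range, Finset.mem_Icc, colorChange_eq]
  have h0 : permVal g.1 0 = 0 := by simp [permVal]
  constructor
  · rintro ⟨hj, h | ⟨h, h'⟩⟩
    · exact Or.inl ⟨hj, h⟩
    · refine Or.inr ⟨⟨⟨?_, by omega⟩, h'⟩, if_pos h⟩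
      rcases Nat.eq_zero_or_pos j with rfl | hp
      · omega
      · exact hp
  · rintro (⟨hj, h⟩ | ⟨⟨hj, h'⟩, h⟩)
    · exact ⟨hj, Or.inl h⟩
    · refine ⟨by omega, Or.inr ⟨?_, h'⟩⟩
      by_contra hne
      simp [hne] at h

theorem disjoint_colorAscents_plainDes {n : ℕ} (g : SignedPerm n) :
    Disjoint (colorAscents g.2) (plainDes g) := by
  rw [Finset.disjoint_left]
  intro j h1 h2
  have h1 := (Finset.mem_filter.1 h1).2
  have h2 := (Finset.mem_filter.1 h2).2
  rw [colorChange_eq, if_neg (by omega)] at h2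
  omega

theorem colorChange_add_color {n : ℕ} (ε : Fin n → ℤˣ) (j : ℕ) :
    colorChange ε j + color ε (j + 1) =
      color ε j + 2 * if color ε j < color ε (j + 1) then 1 else 0 := by
  have h1 := color_le_one ε j
  have h2 := color_le_one ε (j + 1)
  rw [colorChange_eq]
  split_ifs <;> omega

theorem color_lt_color_self_succ {n : ℕ} (ε : Fin n → ℤˣ) : ¬ color ε n < color ε (n + 1) := by
  rw [color_of_lt ε (Nat.lt_succ_self n)]
  omega

theorem sum_range_colorAscents {n : ℕ} (ε : Fin n → ℤˣ) (F : ℕ → ℕ) :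
    ∑ j ∈ Finset.range (n + 1), F j * (if color ε j < color ε (j + 1) then 1 else 0) =
      ∑ j ∈ colorAscents ε, F j := by
  rw [Finset.sum_range_succ, if_neg (color_lt_color_self_succ ε), colorAscents, Finset.sum_filter]
  simp

/-- The colors begin and end at 0, so the changes at `0, …, n` are twice as many as the ascents.
Since `ch(ε)` omits the change at 0, which is at most 1, its half is rounded up. -/
theorem card_colorAscents {n : ℕ} (ε : Fin n → ℤˣ) :
    (colorAscents ε).card = (totalColorChange ε + 1) / 2 := by
  have key : ∀ m, ∑ j ∈ Finset.range m, colorChange ε j + color ε m =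
      2 * ∑ j ∈ Finset.range m, 1 * (if color ε j < color ε (j + 1) then 1 else 0) := by
    intro m
    induction m with
    | zero => simp [color, signVal]
    | succ m ih =>
      have := colorChange_add_color ε m
      rw [Finset.sum_range_succ, Finset.sum_range_succ]
      omega
  have h := key (n + 1)
  rw [sum_range_colorAscents ε fun _ => 1, sum_range_succ_eq_sum_Icc,
    color_of_lt ε (Nat.lt_succ_self n), ← Finset.card_eq_sum_ones] at h
  have h0 : colorChange ε 0 ≤ 1 := by rw [colorChange_eq]; split_ifs <;> omega
  rw [totalColorChange]
  omega

theorem sum_mul_colorChange {n : ℕ} (ε : Fin n → ℤˣ) :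
    ∑ j ∈ Finset.Icc 1 n, j * colorChange ε j =
      2 * ∑ j ∈ colorAscents ε, j + ∑ j ∈ Finset.Icc 1 n, color ε j := by
  -- Summation by parts of `colorChange_add_color`; the boundary term vanishes at `m = n`.
  have key : ∀ m, ∑ j ∈ Finset.range (m + 1), j * colorChange ε j + m * color ε (m + 1) =
      2 * ∑ j ∈ Finset.range (m + 1), j * (if color ε j < color ε (j + 1) then 1 else 0) +
        ∑ j ∈ Finset.Icc 1 m, color ε j := by
    intro m
    induction m with
    | zero => simp
    | succ m ih =>
      have := congrArg ((m + 1) * ·) (colorChange_add_color ε (m + 1))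
      simp only [mul_add] at this
      rw [Finset.sum_range_succ, Finset.sum_range_succ _ (m + 1),
        Finset.sum_Icc_succ_top (by omega)]
      linarith
  have h := key n
  rw [sum_range_colorAscents ε fun j => j, sum_range_succ_eq_sum_Icc,
    color_of_lt ε (Nat.lt_succ_self n)] at h
  omega

theorem card_windowDes {n : ℕ} (g : SignedPerm n) : (windowDes g).card = minLevel g := by
  rw [windowDes_eq_union, Finset.card_union_of_disjoint (disjoint_colorAscents_plainDes g),
    card_colorAscents, minLevel]

/-- The right side is the exponent of `q` in the numerator at `z_i = q`. Color changes contribute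
twice the sum of the color ascents plus `neg`, and plain descents supply the rest. -/
theorem fmajor_eq {n : ℕ} (g : SignedPerm n) :
    fmajor g = ∑ j ∈ Finset.Icc 1 n, j * minGap g j := by
  have hA : ∑ j ∈ windowDesA g, j = ∑ j ∈ windowDes g, j := by
    refine Finset.sum_subset (fun j hj => ?_) fun j hj hj' => ?_
    · simp only [windowDesA, windowDes, Finset.mem_filter, Finset.mem_Icc,
        Finset.mem_range] at hj ⊢
      exact ⟨by omega, hj.2⟩
    · simp only [windowDesA, windowDes, Finset.mem_filter, Finset.mem_Icc,
        Finset.mem_range] at hj hj'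
      by_contra h0
      exact hj' ⟨by omega, hj.2⟩
  have hP : ∑ j ∈ Finset.Icc 1 n, j * (if j ∈ plainDes g then 2 else 0) =
      2 * ∑ j ∈ plainDes g, j := by
    simp only [mul_ite, mul_zero, Finset.sum_ite_mem,
      Finset.inter_eq_right.2 (plainDes_subset g), ← Finset.sum_mul]
    exact mul_comm _ _
  rw [fmajor, hA, windowDes_eq_union, Finset.sum_union (disjoint_colorAscents_plainDes g), negCount]
  simp only [minGap, mul_add, Finset.sum_add_distrib, hP, sum_mul_colorChange]
  ring

/-! ### Specialization to one variable and the bivariate identity. -/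

theorem map_recip {A B : Type*} [CommRing A] [CommRing B] (σ : A →+* B) (f : PowerSeries A)
    (hf : PowerSeries.constantCoeff f = 1) :
    PowerSeries.map σ (recip f) = recip (PowerSeries.map σ f) := by
  refine eq_recip ?_ ?_
  · rw [← PowerSeries.coeff_zero_eq_constantCoeff_apply, PowerSeries.coeff_map,
      PowerSeries.coeff_zero_eq_constantCoeff_apply, hf, map_one]
  · rw [← map_mul, mul_recip f hf, map_one]

/-- The specialization `z_1 = ⋯ = z_n = q`. -/
noncomputable def specialize (R : Type*) [CommRing R] (n : ℕ) :
    MvPolynomial (Fin n) R →+* Polynomial R :=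
  MvPolynomial.eval₂Hom Polynomial.C fun _ => Polynomial.X

theorem specialize_X (R : Type*) [CommRing R] {n : ℕ} (i : Fin n) :
    specialize R n (MvPolynomial.X i) = Polynomial.X := by
  simp [specialize]

theorem specialize_prefixProd (R : Type*) [CommRing R] {n : ℕ} (π : Equiv.Perm (Fin n)) {j : ℕ}
    (hj : j ≤ n) : specialize R n (prefixProd R π j) = Polynomial.X ^ j := by
  simp only [prefixProd, map_prod, specialize_X, Finset.prod_const]
  rw [Fin.card_filter_val_lt, min_eq_right hj]

theorem map_specialize_denom (R : Type*) [CommRing R] {n : ℕ} (π : Equiv.Perm (Fin n)) :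
    PowerSeries.map (specialize R n) (denom R π) = ∏ j ∈ Finset.range (n + 1),
      (1 - PowerSeries.X * PowerSeries.C ((Polynomial.X : Polynomial R) ^ (2 * j))) := by
  rw [denom, map_prod]
  refine Finset.prod_congr rfl fun j hj => ?_
  rw [map_sub, map_one, map_mul, PowerSeries.map_X, PowerSeries.map_C, map_pow,
    specialize_prefixProd R π (Nat.le_of_lt_succ (Finset.mem_range.1 hj)), ← pow_mul, mul_comm j]

theorem map_specialize_numer (R : Type*) [CommRing R] {n : ℕ} (g : SignedPerm n) :
    PowerSeries.map (specialize R n) (numer R g) =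
      PowerSeries.X ^ (windowDes g).card * PowerSeries.C (Polynomial.X ^ fmajor g) := by
  rw [numer_eq, map_mul, map_pow, PowerSeries.map_X, PowerSeries.map_C, map_prod, card_windowDes,
    fmajor_eq, ← Finset.prod_pow_eq_pow_sum]
  congr 2
  refine Finset.prod_congr rfl fun j hj => ?_
  rw [map_pow, specialize_prefixProd R g.1 (Finset.mem_Icc.1 hj).2, ← pow_mul]

/-- After specialization the denominator no longer depends on `π`, so it factors out of the sum. -/
theorem mk_qNumber_pow_eq (R : Type*) [CommRing R] (n : ℕ) :
    PowerSeries.mk (fun k : ℕ => qNumber (2 * k + 1) (Polynomial.X : Polynomial R) ^ n) =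
      (∑ g : SignedPerm n,
        PowerSeries.X ^ (windowDes g).card * PowerSeries.C (Polynomial.X ^ fmajor g)) *
      recip (∏ j ∈ Finset.range (n + 1),
        (1 - PowerSeries.X * PowerSeries.C ((Polynomial.X : Polynomial R) ^ (2 * j)))) := by
  have h := congrArg (PowerSeries.map (specialize R n)) (mk_prod_qNumber_eq R n)
  simp only [map_sum, map_mul, map_recip _ _ (constantCoeff_denom R _), map_specialize_denom,
    map_specialize_numer] at h
  rw [Finset.sum_mul, ← h]
  ext1 k
  simp [qNumber, specialize_X]

theorem sum_natDes_natfmaj {M : Type*} [AddCommMonoid M] {n : ℕ} (F : ℕ → ℕ → M) :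
    ∑ g : SignedPerm n, F (natDes g).card (natfmaj g) =
      ∑ g : SignedPerm n, F (windowDes g).card (fmajor g) := by
  rw [← Equiv.sum_comp reverseNeg_involutive.toPerm]
  refine Finset.sum_congr rfl fun g _ => ?_
  rw [Function.Involutive.coe_toPerm, natDes_reverseNeg, natfmaj_reverseNeg]

/-- The first identity lives in `R[z_1, …, z_n][[z_0]]` and the last one in `R[q][[t]]`;
`PowerSeries.mk a` is the series `∑_{k ≥ 0} a_k z_0^k` (respectively `∑_{k ≥ 0} a_k t^k`). -/
theorem theorem6p7 (R : Type*) [CommRing R] (n : ℕ) :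
    -- the multivariate identity
    (PowerSeries.mk (fun k : ℕ =>
        ∏ j : Fin n, qNumber (2 * k + 1) (MvPolynomial.X j : MvPolynomial (Fin n) R)) =
      ∑ g : SignedPerm n, numer R g * recip (denom R g.1)) ∧
    -- the bijection reversing the relative order of the letters with sign `-1`
    (∃ φ : SignedPerm n ≃ SignedPerm n, ∀ g : SignedPerm n,
      (φ g).2 = g.2 ∧
      (∀ i : Fin n, g.2 i = 1 → (φ g).1 i = g.1 i) ∧
      (∀ i j : Fin n, g.2 i = -1 → g.2 j = -1 → ((φ g).1 i < (φ g).1 j ↔ g.1 j < g.1 i)) ∧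
      natDes (φ g) = windowDes g ∧
      natfmaj (φ g) = fmajor g) ∧
    -- the bivariate identity for `(natdes, natfmaj)`
    (PowerSeries.mk (fun k : ℕ => qNumber (2 * k + 1) (Polynomial.X : Polynomial R) ^ n) =
      (∑ g : SignedPerm n,
        PowerSeries.X ^ (natDes g).card * PowerSeries.C (Polynomial.X ^ natfmaj g)) *
      recip (∏ j ∈ Finset.range (n + 1),
        (1 - PowerSeries.X * PowerSeries.C ((Polynomial.X : Polynomial R) ^ (2 * j))))) := by
  refine ⟨mk_prod_qNumber_eq R n,
    ⟨reverseNeg_involutive.toPerm, fun g => ⟨rfl, fun i => reverseNeg_apply_of_eq_one g,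
      fun i j => reverseNeg_apply_lt_iff g, natDes_reverseNeg g, natfmaj_reverseNeg g⟩⟩, ?_⟩
  rw [mk_qNumber_pow_eq, sum_natDes_natfmaj fun d m => PowerSeries.X ^ d *
    PowerSeries.C ((Polynomial.X : Polynomial R) ^ m)]
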